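/- Let $X$ be a locally noetherian Grothendieck category, i.e. an abelian category with small Hom-sets, with exact direct limits, and with a small set of noetherian generators. Let $Z$ be a closed subcategory of $X$, i.e. a full subcategory closed under subobjects and quotient objects whose inclusion functor $i_*\colon Z\to X$ has a right adjoint $i^!$ and a left adjoint $i^*$. For a small set $I$ let $R^1\prod$ denote the first right derived functor of the product functor $\prod\colon X^I\to X$. Let $o_X$ be the identity functor of $X$ and $o_Z=i_*i^!$, and let $G_Z$ be the cokernel of the natural map $o_Z\to o_X$ in the category of left exact functors $X\to X$; $Z$ is called well-closed in $X$ if $G_Z$ has a left adjoint. A $Z$-projective effacement of an object $M$ is an epimorphism $\pi\colon \underline{M}\to M$ such that for every epimorphism $f\colon P\to M$ with kernel in $Z$ there is $g\colon\underline{M}\to P$ with $fg=\pi$. Then the following are equivalent: 1. $R^1\prod(N_\alpha)=0$ for all small families $\{N_\alpha\}$ of objects in $Z$. 2. $Z$ is well-closed in $X$ and the category $Z$ has exact direct products (that is, $Z$ is very well-closed in $X$). 3. The natural map $\operatorname{Ext}^1(M,\prod_\alpha N_\alpha)\to\prod_\alpha\operatorname{Ext}^1(M,N_\alpha)$ is an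 isomorphism for all small families $\{N_\alpha\}$ of objects in $Z$ and all $M\in X$. 4. Every object $M$ of $X$ has a $Z$-projective effacement. -/

import Mathlib

open CategoryTheory CategoryTheory.Limits

universe v u

namespace ClosedSubcat

section Generalities

variable (X : Type u) [Category.{v} X]

/-- The category `X` has a small set of noetherian generators. -/
def IsLocallyNoetherian : Prop :=
  ∃ (ι : Type v) (O : ι → X),
    (ObjectProperty.ofObj O).IsSeparating ∧ ∀ i, IsNoetherianObject (O i)

variable {X}

/-- A (full) closed subcategory: it is closed under subobjects and quotient objects, and the
inclusion functor has a right adjoint and a left adjoint. -/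
class IsClosedSubcategory (Z : ObjectProperty X) : Prop extends
    Z.IsClosedUnderSubobjects, Z.IsClosedUnderQuotients where
  /-- The inclusion functor has a right adjoint. -/
  isLeftAdjoint_ι : Z.ι.IsLeftAdjoint
  /-- The inclusion functor has a left adjoint. -/
  isRightAdjoint_ι : Z.ι.IsRightAdjoint

attribute [instance] IsClosedSubcategory.isLeftAdjoint_ι IsClosedSubcategory.isRightAdjoint_ι

/-- A closed subcategory of a category with small products has small products. -/
instance hasProducts_of_isClosedSubcategory [HasProducts.{v} X] (Z : ObjectProperty X)
    [IsClosedSubcategory Z] : HasProducts.{v} Z.FullSubcategory := fun J =>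
  haveI : Reflective Z.ι := { L := Z.ι.leftAdjoint, adj := Adjunction.ofIsRightAdjoint Z.ι }
  hasLimitsOfShape_of_reflective (J := Discrete J) Z.ι

end Generalities

section Effacement

variable {X : Type u} [Category.{v} X] [Abelian X]

/-- `π : M' ⟶ M` is an `S`-projective effacement of `M`: it is an epimorphism that factors
through every epimorphism onto `M` with kernel in `S`. -/
structure IsProjectiveEffacement (S : ObjectProperty X) {M' M : X} (π : M' ⟶ M) : Prop where
  epi : Epi π
  exists_lift : ∀ ⦃P : X⦄ (f : P ⟶ M), Epi f → S (kernel f) → ∃ g : M' ⟶ P, g ≫ f = π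

end Effacement

section WellClosed

variable {X : Type u} [Category.{v} X] [Abelian X] (Z : ObjectProperty X) [IsClosedSubcategory Z]

/-- The identity functor, as a left exact functor. -/
def oX : X ⥤ₗ X := ⟨𝟭 X, (inferInstance : PreservesFiniteLimits (𝟭 X))⟩

/-- The left exact functor `o_Z = i_* i^!`, where `i_* : Z ⥤ X` is the inclusion and `i^!` its
right adjoint; it sends an object to its largest subobject that lies in `Z`. -/
noncomputable def oZ : X ⥤ₗ X :=
  ⟨Z.ι.rightAdjoint ⋙ Z.ι, by
    have h₁ : PreservesFiniteLimits Z.ι.rightAdjoint :=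
      have := (Adjunction.ofIsLeftAdjoint Z.ι).rightAdjoint_preservesLimits
      PreservesLimitsOfSize.preservesFiniteLimits.{0, 0} _
    have h₂ : PreservesFiniteLimits Z.ι :=
      have := (Adjunction.ofIsRightAdjoint Z.ι).rightAdjoint_preservesLimits
      PreservesLimitsOfSize.preservesFiniteLimits.{0, 0} _
    exact comp_preservesFiniteLimits Z.ι.rightAdjoint Z.ι⟩

/-- The natural transformation `o_Z ⟶ o_X` given by the counit of the adjunction between `i_*`
and `i^!`, i.e. by the inclusion of the largest subobject that lies in `Z`. -/
noncomputable def oZι : oZ Z ⟶ (oX : X ⥤ₗ X) :=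
  ObjectProperty.homMk (Adjunction.ofIsLeftAdjoint Z.ι).counit

/-- The closed subcategory `Z` is well-closed: the functor `G_Z`, i.e. the cokernel of
`o_Z ⟶ o_X` in the category of left exact functors `X ⥤ X`, has a left adjoint. -/
def IsWellClosed : Prop :=
  ∃ (G : X ⥤ₗ X) (μ : oX ⟶ G) (w : oZι Z ≫ μ = 0),
    Nonempty (IsColimit (CokernelCofork.ofπ μ w)) ∧ G.obj.IsRightAdjoint

end WellClosed

section Derived

variable (X : Type u) [Category.{v} X] [Abelian X]

/-- The functor `∏ : X^I ⥤ X`, where families indexed by `I` are functors on the discrete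
category on `I`. -/
noncomputable abbrev prodFunctor [HasProducts.{v} X] (I : Type v) : (Discrete I ⥤ X) ⥤ X := lim

instance prodFunctor_additive [HasProducts.{v} X] (I : Type v) : (prodFunctor X I).Additive where
  map_add {F G f g} := by
    apply limit.hom_ext
    intro j
    simp

/-- The category of families of objects of `X` has enough injectives if `X` does. -/
instance enoughInjectives_families [EnoughInjectives X] (I : Type v) :
    EnoughInjectives (Discrete I ⥤ X) where
  presentation F := by
    let J : Discrete I ⥤ X := Discrete.functor fun i => Injective.under (F.obj ⟨i⟩)
    let φ : F ⟶ J := Discrete.natTrans fun i => Injective.ι (F.obj i)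
    have : ∀ i, Mono (φ.app i) := fun i => by
      dsimp [φ]; infer_instance
    have : Mono φ := NatTrans.mono_of_mono_app φ
    have : Injective J :=
      { factors := fun {A B} g f hf => by
          refine ⟨Discrete.natTrans fun i =>
            Injective.factorThru (J := Injective.under (F.obj i)) (g.app i) (f.app i), ?_⟩
          ext i
          exact Injective.comp_factorThru (J := Injective.under (F.obj i)) (g.app i) (f.app i) }
    exact ⟨⟨J, inferInstance, φ, inferInstance⟩⟩

variable {X}

/-- The value `R¹∏ (N_α)` of the first right derived functor of the product functor of `X`. -/
noncomputable def R1Prod [HasProducts.{v} X] [EnoughInjectives X] {I : Type v} (N : I → X) : X :=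
  ((prodFunctor X I).rightDerived 1).obj (Discrete.functor N)

/-- The natural map `Ext¹(M, ∏ N_α) → ∏ Ext¹(M, N_α)` induced by the projections. -/
noncomputable def extProdMap [HasProducts.{v} X] [HasExt.{v} X] (M : X) {I : Type v} (N : I → X) :
    Abelian.Ext M (∏ᶜ N) 1 →+ ∀ i, Abelian.Ext M (N i) 1 :=
  AddMonoidHom.pi fun i => (Abelian.Ext.mk₀ (Pi.π N i)).postcomp M (add_zero 1)

end Derived

end ClosedSubcat

/-! All four conditions are equivalent to `JointLifting Z`: for epimorphisms `P i ⟶ M i` with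
kernels in `Z`, any maps `T ⟶ M i` lift simultaneously after one epimorphism `T' ⟶ T`; that is, the
product of the epimorphisms is again an epimorphism. The property is stable under pullback, and
every extension by `N` is a pullback of an injective presentation `N ⟶ J ⟶ J/N`, so presentations
suffice as tests.

For `R¹∏`: since products are left exact, vanishing means that `R⁰ ⟶ ker (R¹ ⟶ R²)` lifts jointly
for an injective resolution of the family. For `Ext¹`: classes are obstructions to lifting maps to
`J/N`, and each class dies on some epimorphism.

An effacement of `T` is a `T' ⟶ T` that serves all families at once. Conversely, over a noetherian
object a small set of epimorphisms, from quotients of finite sums of generators, dominates all those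
with kernel in `Z`; lifting the identity jointly along this set gives an effacement. Coproducts then
handle general objects.

Finally `G_Z` is the zeroth right derived functor of `M ↦ M/o_Z M`. By the special adjoint functor
theorem it has a left adjoint once it preserves products, which follows from joint lifting along the
maps `J ⟶ J/o_Z J`. Since `J ⟶ J/o_Z J` factors through `J/N` with the kernel `o_Z J/N` of the
second map in `Z`, well-closedness and exact products in `Z` together give joint lifting along `J ⟶
J/N`. -/

namespace ClosedSubcat

/-! ### Joint lifting of families of epimorphisms -/

section JointLifting

variable {X : Type u} [Category.{v} X]

/-- A family of morphisms `f i : P i ⟶ M i` lifts jointly if every family of morphisms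
`T ⟶ M i` lifts to the `P i` after composition with a single epimorphism `T' ⟶ T`. -/
def JointlyLifts {I : Type*} {P M : I → X} (f : ∀ i, P i ⟶ M i) : Prop :=
  ∀ ⦃T : X⦄ (y : ∀ i, T ⟶ M i), ∃ (T' : X) (π : T' ⟶ T) (_ : Epi π) (x : ∀ i, T' ⟶ P i),
    ∀ i, π ≫ y i = x i ≫ f i

lemma JointlyLifts.of_isPullback {I : Type*} {P M P' M' : I → X} {f : ∀ i, P i ⟶ M i}
    {f' : ∀ i, P' i ⟶ M' i} {a : ∀ i, P' i ⟶ P i} {b : ∀ i, M' i ⟶ M i}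
    (h : JointlyLifts f) (sq : ∀ i, IsPullback (a i) (f' i) (f i) (b i)) : JointlyLifts f' := by
  intro T y
  obtain ⟨T', π, hπ, x, hx⟩ := h fun i => y i ≫ b i
  exact ⟨T', π, hπ, fun i => (sq i).lift (x i) (π ≫ y i) (by simp [← hx i]), by simp⟩

variable [Abelian X]

/-- Maps into a product are families of maps, and epimorphisms in an abelian category are the maps
along which every map lifts after an epimorphic refinement. -/
lemma jointlyLifts_iff_epi_map {I : Type*} {P M : I → X} [HasProduct P] [HasProduct M]
    (f : ∀ i, P i ⟶ M i) : JointlyLifts f ↔ Epi (Limits.Pi.map f) := by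
  rw [epi_iff_surjective_up_to_refinements]
  constructor
  · intro h T y
    obtain ⟨T', π, hπ, x, hx⟩ := h fun i => y ≫ Pi.π M i
    exact ⟨T', π, hπ, Pi.lift x, by ext i; simpa using hx i⟩
  · intro h T y
    obtain ⟨T', π, hπ, x, hx⟩ := h (Pi.lift y)
    refine ⟨T', π, hπ, fun i => x ≫ Pi.π P i, fun i => ?_⟩
    simpa using hx =≫ Pi.π M i

/-- The property that all families, indexed by types in `Type v`, of epimorphisms with kernels
in `Z` lift jointly. -/
def JointLifting (Z : ObjectProperty X) : Prop :=
  ∀ ⦃I : Type v⦄ ⦃P M : I → X⦄ (f : ∀ i, P i ⟶ M i), (∀ i, Epi (f i)) →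
    (∀ i, Z (kernel (f i))) → JointlyLifts f

/-- A morphism of short exact sequences which is an isomorphism on the left-hand terms is a
pullback square on the right. -/
lemma isPullback_of_shortExact {S₁ S₂ : ShortComplex X} (h₁ : S₁.ShortExact)
    (h₂ : S₂.ShortExact) (φ : S₁ ⟶ S₂) [IsIso φ.τ₁] : IsPullback φ.τ₂ S₁.g S₂.g φ.τ₃ := by
  have := h₁.mono_f
  have := h₁.epi_g
  have := h₂.mono_f
  let c := pullback.lift φ.τ₂ S₁.g φ.comm₂₃
  have hc₁ : c ≫ pullback.fst _ _ = φ.τ₂ := pullback.lift_fst _ _ _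
  have hc₂ : c ≫ pullback.snd _ _ = S₁.g := pullback.lift_snd _ _ _
  have : Mono c := by
    refine Preadditive.mono_of_cancel_zero _ fun {T} x hx => ?_
    have e₁ : x ≫ φ.τ₂ = 0 := by rw [← hc₁, reassoc_of% hx, zero_comp]
    have e₂ : x ≫ S₁.g = 0 := by rw [← hc₂, reassoc_of% hx, zero_comp]
    obtain ⟨n, hn⟩ := h₁.exact.lift' x e₂
    have : n ≫ φ.τ₁ ≫ S₂.f = 0 := by rw [φ.comm₁₂, reassoc_of% hn, e₁]
    have : n = 0 := by
      rw [← cancel_mono φ.τ₁, ← cancel_mono S₂.f]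
      simpa using this
    rw [← hn, this, zero_comp]
  have : Epi c := by
    rw [epi_iff_surjective_up_to_refinements]
    intro T y
    obtain ⟨T', π, hπ, p, hp⟩ :=
      surjective_up_to_refinements_of_epi S₁.g (y ≫ pullback.snd _ _)
    obtain ⟨n, hn⟩ := h₂.exact.lift' (π ≫ y ≫ pullback.fst _ _ - p ≫ φ.τ₂) (by
      rw [Preadditive.sub_comp, Category.assoc, Category.assoc, Category.assoc,
        pullback.condition, reassoc_of% hp, φ.comm₂₃, sub_self])
    refine ⟨T', π, hπ, p + (n ≫ inv φ.τ₁) ≫ S₁.f, pullback.hom_ext ?_ ?_⟩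
    · simp only [Category.assoc, Preadditive.add_comp, hc₁]
      rw [← φ.comm₁₂, IsIso.inv_hom_id_assoc, hn]
      abel
    · simp only [Category.assoc, Preadditive.add_comp, hc₂, hp, S₁.zero, comp_zero, add_zero]
  have : IsIso c := isIso_of_mono_of_epi c
  exact IsPullback.of_iso_pullback ⟨φ.comm₂₃⟩ (asIso c) hc₁ hc₂

/-- Each `(S₁ i).g` is the pullback of `(S₂ i).g` along the map induced on cokernels. In the
applications `u` is the identity and `a` comes from injectivity. -/
lemma JointlyLifts.of_shortExact {I : Type*} {S₁ S₂ : I → ShortComplex X}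
    (h : JointlyLifts fun i => (S₂ i).g) (h₁ : ∀ i, (S₁ i).ShortExact)
    (h₂ : ∀ i, (S₂ i).ShortExact) (u : ∀ i, (S₁ i).X₁ ⟶ (S₂ i).X₁) (hu : ∀ i, IsIso (u i))
    (a : ∀ i, (S₁ i).X₂ ⟶ (S₂ i).X₂) (ha : ∀ i, (S₁ i).f ≫ a i = u i ≫ (S₂ i).f) :
    JointlyLifts fun i => (S₁ i).g := by
  have hb (i : I) : ∃ b, (S₁ i).g ≫ b = a i ≫ (S₂ i).g := by
    obtain ⟨b, hb⟩ := CokernelCofork.IsColimit.desc' (h₁ i).gIsCokernel (a i ≫ (S₂ i).g) (by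
      rw [reassoc_of% ha i, (S₂ i).zero, comp_zero])
    exact ⟨b, hb⟩
  choose b hb using hb
  exact h.of_isPullback fun i => isPullback_of_shortExact (h₁ i) (h₂ i)
    { τ₁ := u i, τ₂ := a i, τ₃ := b i, comm₁₂ := (ha i).symm, comm₂₃ := (hb i).symm }

lemma shortExact_kernel {P M : X} (f : P ⟶ M) [Epi f] :
    (ShortComplex.mk (kernel.ι f) f (kernel.condition _)).ShortExact where
  exact := ShortComplex.exact_kernel f
  mono_f := inferInstanceAs (Mono (kernel.ι f))
  epi_g := ‹Epi f›

lemma shortExact_cokernel {N P : X} (f : N ⟶ P) [Mono f] :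
    (ShortComplex.mk f (cokernel.π f) (cokernel.condition _)).ShortExact where
  exact := ShortComplex.exact_cokernel f
  mono_f := ‹Mono f›
  epi_g := inferInstanceAs (Epi (cokernel.π f))

/-- Products of families of left exact sequences are exact. -/
lemma exact_piMap {I : Type*} {A B C : I → X} [HasProduct A] [HasProduct B] [HasProduct C]
    {f : ∀ i, A i ⟶ B i} {g : ∀ i, B i ⟶ C i} [∀ i, Mono (f i)] (w : ∀ i, f i ≫ g i = 0)
    (h : ∀ i, (ShortComplex.mk (f i) (g i) (w i)).Exact) :
    (ShortComplex.mk (Limits.Pi.map f) (Limits.Pi.map g)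
      (Pi.hom_ext _ _ fun i => by simp [w])).Exact := by
  rw [ShortComplex.exact_iff_exact_up_to_refinements]
  intro T x hx
  choose n hn using fun i => (h i).lift' (x ≫ Pi.π _ i) (by simpa using hx =≫ Pi.π _ i)
  refine ⟨T, 𝟙 T, inferInstance, Pi.lift n, Pi.hom_ext _ _ fun i => ?_⟩
  simp [hn]

lemma prop_kernel_pullback_snd (Z : ObjectProperty X) [Z.IsClosedUnderSubobjects] {P M T : X}
    (f : P ⟶ M) (y : T ⟶ M) (h : Z (kernel f)) : Z (kernel (pullback.snd f y)) := by
  let k : kernel (pullback.snd f y) ⟶ kernel f :=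
    kernel.lift f (kernel.ι _ ≫ pullback.fst f y) (by
      rw [Category.assoc, pullback.condition, kernel.condition_assoc, zero_comp])
  have : Mono k := by
    refine Preadditive.mono_of_cancel_zero _ fun {T} x hx => ?_
    rw [← cancel_mono (kernel.ι _)]
    refine pullback.hom_ext ?_ (by simp)
    simpa [k] using hx =≫ kernel.ι f
  exact Z.prop_of_mono k h

/-- The pullback of `f` along `y` is an epimorphism onto `M` whose kernel embeds in that of `f`. -/
lemma IsProjectiveEffacement.exists_lift_of_hom {Z : ObjectProperty X}
    [Z.IsClosedUnderSubobjects] {M' M : X} {π : M' ⟶ M} (hπ : IsProjectiveEffacement Z π)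
    {P B : X} (f : P ⟶ B) [Epi f] (hf : Z (kernel f)) (y : M ⟶ B) :
    ∃ g : M' ⟶ P, g ≫ f = π ≫ y := by
  obtain ⟨g, hg⟩ := hπ.exists_lift (pullback.snd f y) inferInstance
    (prop_kernel_pullback_snd Z f y hf)
  exact ⟨g ≫ pullback.fst f y, by rw [Category.assoc, pullback.condition, reassoc_of% hg]⟩

lemma jointLifting_of_exists_effacement {Z : ObjectProperty X} [Z.IsClosedUnderSubobjects]
    (h : ∀ M : X, ∃ (M' : X) (π : M' ⟶ M), IsProjectiveEffacement Z π) : JointLifting Z := by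
  intro I P M f hf hZ T y
  obtain ⟨T', π, hπ⟩ := h T
  choose g hg using fun i => have := hf i; hπ.exists_lift_of_hom (f i) (hZ i) (y i)
  exact ⟨T', π, hπ.epi, g, fun i => (hg i).symm⟩

end JointLifting

/-! ### Effacements from noetherian generators -/

section Noetherian

variable {X : Type u} [Category.{v} X] [Abelian X]

open scoped ZeroObject

/-- The direct sum of the objects `O i`, where `i` runs through a list. -/
noncomputable def listSum {ι : Type*} (O : ι → X) : List ι → X
  | [] => 0
  | i :: l => O i ⊞ listSum O l

lemma exists_desc_listSum {ι : Type*} {O : ι → X} (i : ι) (l : List ι) {P : X} (g : O i ⟶ P)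
    (h : listSum O l ⟶ P) : ∃ (a : O i ⟶ listSum O (i :: l))
      (b : listSum O l ⟶ listSum O (i :: l)) (h' : listSum O (i :: l) ⟶ P),
        a ≫ h' = g ∧ b ≫ h' = h :=
  ⟨(biprod.inl : O i ⟶ O i ⊞ listSum O l), (biprod.inr : listSum O l ⟶ O i ⊞ listSum O l),
    (biprod.desc g h : O i ⊞ listSum O l ⟶ P), biprod.inl_desc _ _, biprod.inr_desc _ _⟩

lemma epi_of_forall_factors {ι : Type*} {O : ι → X}
    (hO : (ObjectProperty.ofObj O).IsSeparating) {P M : X} (f : P ⟶ M) [Epi f]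
    (m : Subobject M) (h : ∀ (i : ι) (g : O i ⟶ P), m.Factors (g ≫ f)) : m = ⊤ := by
  have : f ≫ cokernel.π m.arrow = 0 := by
    refine hO _ _ ?_
    rintro _ ⟨i⟩ g
    rw [← Category.assoc, ← m.factorThru_arrow _ (h i g), Category.assoc, cokernel.condition,
      comp_zero, comp_zero]
  have h0 : cokernel.π m.arrow = 0 := by rw [← cancel_epi f, this, comp_zero]
  have : Epi m.arrow := Preadditive.epi_of_cokernel_zero h0
  have : IsIso m.arrow := isIso_of_mono_of_epi _
  exact Subobject.eq_top_of_isIso_arrow m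

/-- An epimorphism onto a noetherian object remains an epimorphism on a finite sum of
generators. -/
lemma exists_epi_from_listSum {ι : Type*} {O : ι → X}
    (hO : (ObjectProperty.ofObj O).IsSeparating) {P M : X} [IsNoetherianObject M]
    (f : P ⟶ M) [Epi f] : ∃ (l : List ι) (h : listSum O l ⟶ P), Epi (h ≫ f) := by
  let s : Set (Subobject M) :=
    {m | ∃ (l : List ι) (h : listSum O l ⟶ P), m = imageSubobject (h ≫ f)}
  have hwf : WellFounded ((· > ·) : Subobject M → Subobject M → Prop) := wellFounded_gt
  -- A minimal element for `>` is a maximal image of a finite sum; adjoining one more generator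
  -- cannot enlarge it, so it contains the images of all generators.
  obtain ⟨m, ⟨l, h, rfl⟩, hm⟩ := hwf.has_min s ⟨_, [], 0, rfl⟩
  refine ⟨l, h, ?_⟩
  have key : imageSubobject (h ≫ f) = ⊤ := by
    refine epi_of_forall_factors hO f _ fun i g => ?_
    obtain ⟨a, b, h', h₁, h₂⟩ := exists_desc_listSum i l g h
    have hle : imageSubobject (h ≫ f) ≤ imageSubobject (h' ≫ f) := by
      rw [← h₂, Category.assoc]
      exact imageSubobject_comp_le _ _
    have heq : imageSubobject (h ≫ f) = imageSubobject (h' ≫ f) :=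
      hle.eq_of_not_lt fun hlt => hm _ ⟨_, h', rfl⟩ hlt
    rw [heq, ← h₁, Category.assoc]
    exact Subobject.factors_of_factors_right _
      ((Subobject.factors_iff _ _).2 ⟨factorThruImageSubobject _, imageSubobject_arrow_comp _⟩)
  rw [← imageSubobject_arrow_comp (h ≫ f)]
  have : IsIso (imageSubobject (h ≫ f)).arrow := (Subobject.isIso_iff_mk_eq_top _).2 (by simpa)
  exact epi_comp _ _

/-- Any epimorphism `f : P ⟶ M` with kernel in `Z` restricts to an epimorphism on the image in `P`
of a finite sum of generators. Such images are quotients of finite sums, hence form a small set up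
to isomorphism. -/
lemma exists_effacement_of_isNoetherianObject [WellPowered.{v} X] {Z : ObjectProperty X}
    [Z.IsClosedUnderSubobjects] (hZ : JointLifting Z) {ι : Type v} {O : ι → X}
    (hO : (ObjectProperty.ofObj O).IsSeparating) (M : X) [IsNoetherianObject M] :
    ∃ (M' : X) (π : M' ⟶ M), IsProjectiveEffacement Z π := by
  let Q (l : List ι) (s : Shrink.{v} (Subobject (listSum O l))) : X :=
    cokernel ((equivShrink.{v} _).symm s).arrow
  let Λ := Σ (l : List ι) (s : Shrink.{v} (Subobject (listSum O l))),
    {f : Q l s ⟶ M // Epi f ∧ Z (kernel f)}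
  -- The constant family of identities is lifted along all the test epimorphisms at once.
  obtain ⟨T, π, hπ, x, hx⟩ := hZ (I := Λ) (M := fun _ => M) (fun a => a.2.2.1)
    (fun a => a.2.2.2.1) (fun a => a.2.2.2.2) (fun _ => 𝟙 M)
  refine ⟨T, π, hπ, fun P f hf hk => ?_⟩
  obtain ⟨l, h, he⟩ := exists_epi_from_listSum hO f
  let s := equivShrink.{v} _ (kernelSubobject h)
  have hs : (equivShrink.{v} _).symm s = kernelSubobject h := Equiv.symm_apply_apply _ _
  obtain ⟨m, hm, hmono⟩ : ∃ m : Q l s ⟶ P, cokernel.π _ ≫ m = h ∧ Mono m := by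
    dsimp only [Q]
    rw [hs]
    let S := ShortComplex.mk (kernelSubobject h).arrow h (kernelSubobject_arrow_comp h)
    have hS : S.Exact := S.exact_of_f_is_kernel (by
      refine IsLimit.ofIsoLimit (kernelIsKernel h)
        (Fork.ext (kernelSubobjectIso h).symm ?_)
      simp [S])
    exact ⟨cokernel.desc _ h S.zero, cokernel.π_desc _ _ _, hS.mono_cokernelDesc⟩
  have hmf : Epi (m ≫ f) := by
    have : Epi (cokernel.π ((equivShrink.{v} _).symm s).arrow ≫ m ≫ f) := by
      rwa [reassoc_of% hm]
    exact epi_of_epi (cokernel.π ((equivShrink.{v} _).symm s).arrow) _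
  have hmk : Z (kernel (m ≫ f)) := by
    let k : kernel (m ≫ f) ⟶ kernel f := kernel.lift f (kernel.ι (m ≫ f) ≫ m) (by simp)
    have : Mono (k ≫ kernel.ι f) := by
      rw [kernel.lift_ι]
      infer_instance
    have : Mono k := mono_of_mono k (kernel.ι f)
    exact Z.prop_of_mono k hk
  refine ⟨x ⟨l, s, m ≫ f, hmf, hmk⟩ ≫ m, ?_⟩
  have := hx ⟨l, s, m ≫ f, hmf, hmk⟩
  simpa using this.symm

/-- `M` is a quotient of the coproduct of generators over all maps to it; the coproduct of their
effacements works, since lifts may be chosen on each summand. -/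
lemma exists_effacement [HasCoproducts.{v} X] [WellPowered.{v} X] (hX : IsLocallyNoetherian X)
    {Z : ObjectProperty X} [Z.IsClosedUnderSubobjects] (hZ : JointLifting Z) (M : X) :
    ∃ (M' : X) (π : M' ⟶ M), IsProjectiveEffacement Z π := by
  obtain ⟨ι, O, hO, hN⟩ := hX
  choose O' π hπ using fun i => exists_effacement_of_isNoetherianObject hZ hO (O i)
  let a : (∐ fun p : Σ i, O i ⟶ M => O' p.1) ⟶ ∐ fun p : Σ i, O i ⟶ M => O p.1 :=
    Limits.Sigma.map fun p => π p.1
  let b : (∐ fun p : Σ i, O i ⟶ M => O p.1) ⟶ M := Sigma.desc fun p => p.2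
  have : ∀ i, Epi (π i) := fun i => (hπ i).epi
  have : Epi a := by dsimp only [a]; infer_instance
  have : Epi b := by
    refine Preadditive.epi_of_cancel_zero _ fun {T} g hg => hO _ _ ?_
    rintro _ ⟨i⟩ h
    rw [comp_zero]
    simpa [b] using Sigma.ι (fun p : Σ i, O i ⟶ M => O p.1) ⟨i, h⟩ ≫= hg
  refine ⟨_, a ≫ b, epi_comp _ _, fun P f hf hk => ?_⟩
  choose g hg using fun p : Σ i, O i ⟶ M => (hπ p.1).exists_lift_of_hom f hk p.2
  refine ⟨Sigma.desc g, Sigma.hom_ext _ _ fun p => ?_⟩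
  simp [a, b, hg]

end Noetherian

/-! ### Derived functor of the product -/

section DerivedProduct

variable {X : Type u} [Category.{v} X] [Abelian X]

lemma shortExact_kernelLift {S : ShortComplex X} {N : X} (k : N ⟶ S.X₁) (hm : Mono k)
    (w : k ≫ S.f = 0) (hk : (ShortComplex.mk k S.f w).Exact) (hS : S.Exact) :
    (ShortComplex.mk k (kernel.lift S.g S.f S.zero)
      (by rw [← cancel_mono (kernel.ι S.g)]; simpa using w)).ShortExact where
  exact := by
    rw [ShortComplex.exact_iff_exact_up_to_refinements]
    intro T x hx
    obtain ⟨n, hn⟩ := hk.lift' x (by simpa using hx =≫ kernel.ι S.g)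
    exact ⟨T, 𝟙 T, inferInstance, n, by simpa using hn.symm⟩
  mono_f := hm
  epi_g := S.exact_iff_epi_kernel_lift.1 hS

/-- The exact sequence of families `0 ⟶ N ⟶ R⁰ ⟶ ker (R¹ ⟶ R²) ⟶ 0` evaluated at an index. -/
lemma exists_shortExact_resolution {I : Type v} {N : I → X}
    (R : InjectiveResolution (Discrete.functor N)) :
    ∃ (k : Discrete.functor N ⟶ R.cocomplex.X 0) (_ : Mono k)
      (w : ∀ i, k.app ⟨i⟩ ≫ kernel.lift ((R.cocomplex.d 1 2).app ⟨i⟩)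
        ((R.cocomplex.d 0 1).app ⟨i⟩) (by
          rw [← NatTrans.comp_app, R.cocomplex.d_comp_d]; rfl) = 0),
      ∀ i, (ShortComplex.mk _ _ (w i)).ShortExact := by
  obtain ⟨k, this, w, hk⟩ : ∃ (k : Discrete.functor N ⟶ R.cocomplex.X 0) (_ : Mono k)
      (w : k ≫ R.cocomplex.d 0 1 = 0), (ShortComplex.mk k _ w).Exact :=
    ⟨R.ι.f 0, inferInstanceAs (Mono (R.ι.f 0)), R.ι_f_zero_comp_complex_d, R.exact₀⟩
  suffices h : ∀ i, ∃ w, (ShortComplex.mk (k.app ⟨i⟩) (kernel.lift ((R.cocomplex.d 1 2).app ⟨i⟩)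
      ((R.cocomplex.d 0 1).app ⟨i⟩) (by
        rw [← NatTrans.comp_app, R.cocomplex.d_comp_d]; rfl)) w).ShortExact from
    ⟨k, this, fun i => (h i).choose, fun i => (h i).choose_spec⟩
  intro i
  have hk := hk.map ((evaluation _ X).obj ⟨i⟩)
  have hS := (R.exact_succ 0).map ((evaluation _ X).obj ⟨i⟩)
  have : Mono (k.app ⟨i⟩) := inferInstanceAs (Mono (((evaluation _ X).obj ⟨i⟩).map k))
  exact ⟨_, shortExact_kernelLift
    (S := (ShortComplex.mk _ _ (R.cocomplex.d_comp_d 0 1 2)).map ((evaluation _ X).obj ⟨i⟩))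
    (k.app ⟨i⟩) this _ hk hS⟩

variable [HasProducts.{v} X]

lemma exact_map_prodFunctor_iff_refinements {I : Type v} (S : ShortComplex (Discrete I ⥤ X)) :
    (S.map (prodFunctor X I)).Exact ↔ ∀ ⦃T : X⦄ (y : T ⟶ limit S.X₂), y ≫ limMap S.g = 0 →
      ∃ (T' : X) (π : T' ⟶ T) (_ : Epi π) (x : T' ⟶ limit S.X₁), π ≫ y = x ≫ limMap S.f :=
  ShortComplex.exact_iff_exact_up_to_refinements _

/-- The kernel of a product of maps is the product of the kernels, so exactness in the middle asks
the maps to these kernels to have an epimorphic product. -/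
lemma exact_map_prodFunctor_iff {I : Type v} (S : ShortComplex (Discrete I ⥤ X)) :
    (S.map (prodFunctor X I)).Exact ↔ JointlyLifts fun i =>
      kernel.lift (S.g.app ⟨i⟩) (S.f.app ⟨i⟩) (by rw [← NatTrans.comp_app, S.zero]; rfl) := by
  rw [exact_map_prodFunctor_iff_refinements]
  constructor
  · intro h T y
    obtain ⟨T', π, hπ, x, hx⟩ := h (T := T)
      (limit.lift S.X₂ ⟨T, Discrete.natTrans fun i => y i.as ≫ kernel.ι _⟩) (by
        refine limit.hom_ext fun i => ?_
        simp)
    refine ⟨T', π, hπ, fun i => x ≫ limit.π S.X₁ ⟨i⟩, fun i => ?_⟩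
    rw [← cancel_mono (kernel.ι _)]
    simpa using hx =≫ limit.π S.X₂ ⟨i⟩
  · intro h T y hy
    have hy' (i : I) : (y ≫ limit.π S.X₂ ⟨i⟩) ≫ S.g.app ⟨i⟩ = 0 := by
      simpa using hy =≫ limit.π S.X₃ ⟨i⟩
    obtain ⟨T', π, hπ, x, hx⟩ := h fun i => kernel.lift _ _ (hy' i)
    refine ⟨T', π, hπ, limit.lift S.X₁ ⟨T', Discrete.natTrans fun i => x i.as⟩, ?_⟩
    refine limit.hom_ext fun ⟨i⟩ => ?_
    simpa using hx i =≫ kernel.ι _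

variable [EnoughInjectives X]

lemma isZero_R1Prod_iff {I : Type v} (N : I → X)
    (R : InjectiveResolution (Discrete.functor N)) :
    IsZero (R1Prod N) ↔ JointlyLifts fun i =>
      kernel.lift ((R.cocomplex.d 1 2).app ⟨i⟩) ((R.cocomplex.d 0 1).app ⟨i⟩) (by
        rw [← NatTrans.comp_app, R.cocomplex.d_comp_d]; rfl) := by
  rw [← exact_map_prodFunctor_iff (ShortComplex.mk _ _ (R.cocomplex.d_comp_d 0 1 2))]
  refine (R.isoRightDerivedObj (prodFunctor X I) 1).isZero_iff.trans ?_
  refine (HomologicalComplex.exactAt_iff_isZero_homology _ _).symm.trans ?_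
  exact HomologicalComplex.exactAt_iff' _ 0 1 2 (by simp) (by simp)

lemma isZero_R1Prod {Z : ObjectProperty X} [Z.IsClosedUnderSubobjects] (hZ : JointLifting Z)
    {I : Type v} (N : I → X) (hN : ∀ i, Z (N i)) : IsZero (R1Prod N) := by
  let R := injectiveResolution (Discrete.functor N)
  obtain ⟨k, hk, w, hw⟩ := exists_shortExact_resolution R
  rw [isZero_R1Prod_iff N R]
  refine hZ _ (fun i => ?_) fun i => ?_
  · exact (hw i).epi_g
  · let e := IsLimit.conePointUniqueUpToIso (hw i).fIsKernel (kernelIsKernel _)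
    exact Z.prop_of_mono e.inv (hN i)

lemma jointLifting_of_isZero_R1Prod {Z : ObjectProperty X}
    (h : ∀ (I : Type v) (N : I → X), (∀ i, Z (N i)) → IsZero (R1Prod N)) : JointLifting Z := by
  intro I P M f hf hZ
  let N (i : I) : X := kernel (f i)
  let R := injectiveResolution (Discrete.functor N)
  obtain ⟨k, hk, w, hw⟩ := exists_shortExact_resolution R
  have hR := (isZero_R1Prod_iff N R).1 (h I N hZ)
  let κ : Discrete.functor N ⟶ Discrete.functor P := Discrete.natTrans fun i => kernel.ι (f i.as)
  have : ∀ i, Mono (κ.app i) := fun i => by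
    dsimp [κ, N]; infer_instance
  have : Mono κ := NatTrans.mono_of_mono_app κ
  -- Injectivity of `R⁰` maps the given extensions of `M i` by `N i` to `N ⟶ R⁰ ⟶ ker (R¹ ⟶ R²)`,
  -- exhibiting `f` as a family of pullbacks.
  let α : Discrete.functor P ⟶ R.cocomplex.X 0 := Injective.factorThru k κ
  have hα (i : I) : kernel.ι (f i) ≫ α.app ⟨i⟩ = k.app ⟨i⟩ :=
    NatTrans.congr_app (Injective.comp_factorThru k κ) ⟨i⟩
  exact hR.of_shortExact (S₁ := fun i => ShortComplex.mk (kernel.ι (f i)) (f i) _)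
    (S₂ := fun i => ShortComplex.mk _ _ (w i)) (fun i => have := hf i; shortExact_kernel (f i)) hw
    (fun i => 𝟙 (N i)) (fun i => inferInstanceAs (IsIso (𝟙 (N i)))) (fun i => α.app ⟨i⟩)
    fun i => (hα i).trans (Category.id_comp (k.app ⟨i⟩)).symm

end DerivedProduct

/-! ### Ext groups and products -/

section Ext

open Abelian

variable {X : Type u} [Category.{v} X] [Abelian X] [HasExt.{v} X]

/-- The class is the obstruction to lifting some `g : M ⟶ J/N` to the injective `J`; over the
pullback of `J` along `g` a lift exists. -/
lemma exists_mk₀_comp_eq_zero [EnoughInjectives X] {M N : X} (x : Ext M N 1) :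
    ∃ (T : X) (π : T ⟶ M), Epi π ∧ (Ext.mk₀ π).comp x (zero_add 1) = 0 := by
  let S := ShortComplex.mk (Injective.ι N) (cokernel.π (Injective.ι N)) (cokernel.condition _)
  have hS : S.ShortExact := shortExact_cokernel _
  have : Injective S.X₂ := inferInstanceAs (Injective (Injective.under N))
  have : Epi S.g := hS.epi_g
  obtain ⟨x₃, rfl⟩ := Ext.covariant_sequence_exact₁ M hS x (Ext.eq_zero_of_injective _) (zero_add 1)
  obtain ⟨g, rfl⟩ := (Ext.mk₀_bijective M S.X₃).2 x₃
  refine ⟨pullback S.g g, pullback.snd S.g g, inferInstance, ?_⟩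
  rw [Ext.mk₀_comp_mk₀_assoc, ← pullback.condition, ← Ext.mk₀_comp_mk₀_assoc, hS.comp_extClass,
    Ext.comp_zero]

lemma exists_lift_of_mk₀_comp_extClass_eq_zero {S : ShortComplex X} (hS : S.ShortExact) {T : X}
    (y : T ⟶ S.X₃) (hy : (Ext.mk₀ y).comp hS.extClass (zero_add 1) = 0) :
    ∃ x : T ⟶ S.X₂, x ≫ S.g = y := by
  obtain ⟨x₂, hx₂⟩ := Ext.covariant_sequence_exact₃ T hS (Ext.mk₀ y) (zero_add 1) hy
  obtain ⟨x, rfl⟩ := (Ext.mk₀_bijective T S.X₂).2 x₂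
  refine ⟨x, (Ext.mk₀_bijective T S.X₃).1 ?_⟩
  rw [← hx₂, Ext.mk₀_comp_mk₀]

variable [HasProducts.{v} X]

lemma extProdMap_apply (M : X) {I : Type v} (N : I → X) (x : Ext M (∏ᶜ N) 1) (i : I) :
    extProdMap M N x i = x.comp (Ext.mk₀ (Pi.π N i)) (add_zero 1) := rfl

/-- Surjectivity of the comparison map assembles the obstructions to lifting the `y i` into one
class; an epimorphism `T' ⟶ T` that kills this class kills all of them. -/
lemma jointLifting_of_bijective_extProdMap [EnoughInjectives X] {Z : ObjectProperty X}
    (h : ∀ (I : Type v) (N : I → X), (∀ i, Z (N i)) →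
      ∀ M : X, Function.Bijective (extProdMap M N)) : JointLifting Z := by
  intro I P M f hf hZ T y
  have hS (i : I) : (ShortComplex.mk (kernel.ι (f i)) (f i) (kernel.condition _)).ShortExact :=
    have := hf i
    shortExact_kernel (f i)
  obtain ⟨e, he⟩ := (h I (fun i => kernel (f i)) hZ T).2
    fun i => (Ext.mk₀ (y i)).comp (hS i).extClass (zero_add 1)
  obtain ⟨T', π, hπ, hπe⟩ := exists_mk₀_comp_eq_zero e
  choose x hx using fun i => exists_lift_of_mk₀_comp_extClass_eq_zero (hS i) (π ≫ y i) (by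
    rw [← Ext.mk₀_comp_mk₀_assoc]
    have := congr_fun he i
    rw [extProdMap_apply] at this
    rw [← this, ← Ext.comp_assoc _ _ _ (zero_add 1) (add_zero 1) (by lia), hπe, Ext.zero_comp])
  exact ⟨T', π, hπ, x, fun i => (hx i).symm⟩

/-- Joint lifting makes the product of the injective presentations of the `N i` short exact, hence
an injective presentation of `∏ᶜ N`. Both sides are then computed as maps from `M` to the cokernels
modulo liftable ones. -/
lemma bijective_extProdMap [EnoughInjectives X] {Z : ObjectProperty X}
    [Z.IsClosedUnderSubobjects] (hZ : JointLifting Z) {I : Type v} (N : I → X)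
    (hN : ∀ i, Z (N i)) (M : X) : Function.Bijective (extProdMap M N) := by
  let S (i : I) := ShortComplex.mk (Injective.ι (N i)) (cokernel.π (Injective.ι (N i)))
    (cokernel.condition _)
  have hS (i : I) : (S i).ShortExact := shortExact_cokernel _
  let S' := ShortComplex.mk (Limits.Pi.map fun i => (S i).f) (Limits.Pi.map fun i => (S i).g)
    (Pi.hom_ext _ _ fun i => by simp)
  have hS' : S'.ShortExact :=
    { exact := by
        have := fun i => (hS i).mono_f
        exact exact_piMap (fun i => (S i).zero) fun i => (hS i).exact
      mono_f := by
        have := fun i => (hS i).mono_f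
        dsimp only [S']
        infer_instance
      epi_g := by
        refine (jointlyLifts_iff_epi_map _).1 (hZ _ (fun i => (hS i).epi_g) fun i => ?_)
        let e := IsLimit.conePointUniqueUpToIso (hS i).fIsKernel (kernelIsKernel _)
        exact Z.prop_of_mono e.inv (hN i) }
  have : ∀ i, Injective (S i).X₂ := fun i => inferInstanceAs (Injective (Injective.under (N i)))
  have : Injective S'.X₂ := inferInstanceAs (Injective (∏ᶜ fun i => (S i).X₂))
  let φ (i : I) : S' ⟶ S i :=
    { τ₁ := Pi.π _ i
      τ₂ := Pi.π _ i
      τ₃ := Pi.π _ i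
      comm₁₂ := by simp [S']
      comm₂₃ := by simp [S'] }
  have key (g : M ⟶ S'.X₃) (i : I) :
      extProdMap M N ((Ext.mk₀ g).comp hS'.extClass (zero_add 1)) i =
        (Ext.mk₀ (g ≫ (φ i).τ₃)).comp (hS i).extClass (zero_add 1) := by
    rw [extProdMap_apply, Ext.comp_assoc _ _ _ (zero_add 1) (add_zero 1) (by lia)]
    refine (congrArg (fun z => (Ext.mk₀ g).comp z (zero_add 1))
      (ShortComplex.ShortExact.extClass_naturality hS' (hS i) (φ i))).trans ?_
    rw [Ext.mk₀_comp_mk₀_assoc]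
  constructor
  · rw [injective_iff_map_eq_zero]
    intro x hx
    obtain ⟨x₃, rfl⟩ :=
      Ext.covariant_sequence_exact₁ M hS' x (Ext.eq_zero_of_injective _) (zero_add 1)
    obtain ⟨g, rfl⟩ := (Ext.mk₀_bijective M S'.X₃).2 x₃
    choose a ha using fun i => exists_lift_of_mk₀_comp_extClass_eq_zero (hS i) (g ≫ (φ i).τ₃) (by
      rw [← key, hx]; rfl)
    have hg : Pi.lift a ≫ S'.g = g := Pi.hom_ext _ _ fun i => by
      simpa [S', φ] using ha i
    rw [← hg, ← Ext.mk₀_comp_mk₀_assoc, hS'.comp_extClass, Ext.comp_zero]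
  · intro y
    have (i : I) : ∃ g : M ⟶ (S i).X₃, (Ext.mk₀ g).comp (hS i).extClass (zero_add 1) = y i := by
      obtain ⟨x₃, hx₃⟩ :=
        Ext.covariant_sequence_exact₁ M (hS i) (y i) (Ext.eq_zero_of_injective _) (zero_add 1)
      obtain ⟨g, rfl⟩ := (Ext.mk₀_bijective M (S i).X₃).2 x₃
      exact ⟨g, hx₃⟩
    choose g hg using this
    refine ⟨(Ext.mk₀ (Pi.lift g)).comp hS'.extClass (zero_add 1), funext fun i => ?_⟩
    rw [key, ← hg i]
    simp [φ]

end Ext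

/-! ### Reflection of a functor into left exact functors -/

section LeftExactReflection

variable {X : Type u} [Category.{v} X] [Abelian X] (F : X ⥤ X)

/-- The difference `g - g'` factors through `cokernel.π i`. This is what makes the constructions
below independent of the chosen extensions to injectives. -/
lemma map_eq_map_of_comp_eq [F.Additive] {M B C : X} (i : M ⟶ B) {T : X} (t : T ⟶ F.obj B)
    (ht : t ≫ F.map (cokernel.π i) = 0) (g g' : B ⟶ C) (h : i ≫ g = i ≫ g') :
    t ≫ F.map g = t ≫ F.map g' := by
  have hz : i ≫ (g - g') = 0 := by rw [Preadditive.comp_sub, h, sub_self]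
  rw [← sub_eq_zero, ← Preadditive.comp_sub, ← F.map_sub, ← cokernel.π_desc i _ hz, F.map_comp,
    reassoc_of% ht, zero_comp]

/-- The natural map from the cokernel of `S.f` to the cokernel of the composition of `S.f` with
a monomorphism is a monomorphism. -/
lemma mono_of_shortExact_of_comp {S : ShortComplex X} (hS : S.ShortExact) {J : X} (i : S.X₂ ⟶ J)
    [Mono i] (m : S.X₃ ⟶ cokernel (S.f ≫ i)) (hm : S.g ≫ m = i ≫ cokernel.π (S.f ≫ i)) :
    Mono m := by
  have := hS.mono_f
  have := hS.epi_g
  refine Preadditive.mono_of_cancel_zero _ fun {T} c hc => ?_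
  obtain ⟨T', π, hπ, b, hb⟩ := surjective_up_to_refinements_of_epi S.g c
  obtain ⟨a, ha⟩ := (ShortComplex.exact_cokernel (S.f ≫ i)).lift' (b ≫ i) (by
    dsimp
    rw [Category.assoc, ← hm, ← reassoc_of% hb, hc, comp_zero])
  have ha' : a ≫ S.f = b := by
    rw [← cancel_mono i, Category.assoc]
    exact ha
  rw [← cancel_epi π, hb, ← ha', Category.assoc, S.zero, comp_zero, comp_zero]

lemma exact_map_of_exists_lift [F.PreservesZeroMorphisms] (S : ShortComplex X)
    (h : ∀ ⦃T : X⦄ (x : T ⟶ F.obj S.X₂), x ≫ F.map S.g = 0 →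
      ∃ y : T ⟶ F.obj S.X₁, y ≫ F.map S.f = x) : (S.map F).Exact := by
  rw [ShortComplex.exact_iff_exact_up_to_refinements]
  intro T x hx
  obtain ⟨y, hy⟩ := h x hx
  exact ⟨T, 𝟙 T, inferInstance, y, (Category.id_comp x).trans hy.symm⟩

lemma exists_lift_map [F.Additive] [PreservesFiniteLimits F] {S : ShortComplex X}
    (hS : S.ShortExact) {T : X} (x : T ⟶ F.obj S.X₂) (hx : x ≫ F.map S.g = 0) :
    ∃ y : T ⟶ F.obj S.X₁, y ≫ F.map S.f = x := by
  have h := F.preservesFiniteLimits_iff_forall_exact_map_and_mono.1 inferInstance S hS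
  have : Mono (S.map F).f := h.2
  exact h.1.lift' x hx

variable [EnoughInjectives X]

/-- The value at `M` of the zeroth right derived functor of `F`, computed from the embedding
of `M` into an injective object. -/
noncomputable def derivedObj (M : X) : X := kernel (F.map (cokernel.π (Injective.ι M)))

/-- The inclusion of `derivedObj F M` in the value of `F` at the injective object containing
`M`. -/
noncomputable def derivedObjι (M : X) : derivedObj F M ⟶ F.obj (Injective.under M) :=
  kernel.ι _

instance (M : X) : Mono (derivedObjι F M) := inferInstanceAs (Mono (kernel.ι _))

lemma derivedObjι_comp (M : X) : derivedObjι F M ≫ F.map (cokernel.π (Injective.ι M)) = 0 :=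
  kernel.condition _

variable [F.Additive]

lemma derivedObjι_map_comp {M M' : X} (f : M ⟶ M')
    (g : Injective.under M ⟶ Injective.under M') (hg : Injective.ι M ≫ g = f ≫ Injective.ι M') :
    (derivedObjι F M ≫ F.map g) ≫ F.map (cokernel.π (Injective.ι M')) = 0 := by
  rw [Category.assoc, ← F.map_comp,
    map_eq_map_of_comp_eq F _ _ (derivedObjι_comp F M) (g ≫ cokernel.π (Injective.ι M')) 0
      (by rw [reassoc_of% hg]; simp), F.map_zero, comp_zero]

/-- The functoriality of `derivedObj`. -/
noncomputable def derivedMap {M M' : X} (f : M ⟶ M') : derivedObj F M ⟶ derivedObj F M' :=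
  kernel.lift _
    (derivedObjι F M ≫ F.map (Injective.factorThru (f ≫ Injective.ι M') (Injective.ι M)))
    (derivedObjι_map_comp F f _ (Injective.comp_factorThru _ _))

lemma derivedMap_ι {M M' : X} (f : M ⟶ M')
    (g : Injective.under M ⟶ Injective.under M') (hg : Injective.ι M ≫ g = f ≫ Injective.ι M') :
    derivedMap F f ≫ derivedObjι F M' = derivedObjι F M ≫ F.map g :=
  (kernel.lift_ι _ _ _).trans (map_eq_map_of_comp_eq F _ _ (derivedObjι_comp F M) _ _
    ((Injective.comp_factorThru _ _).trans hg.symm))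

/-- The zeroth right derived functor of `F`. -/
noncomputable def derived : X ⥤ X where
  obj M := derivedObj F M
  map f := derivedMap F f
  map_id M := by
    rw [← cancel_mono (derivedObjι F M), derivedMap_ι F (𝟙 M) (𝟙 _) (by simp)]
    simp
  map_comp {M M' M''} f g := by
    rw [← cancel_mono (derivedObjι F M''),
      derivedMap_ι F (f ≫ g) (Injective.factorThru (f ≫ Injective.ι M') (Injective.ι M) ≫
        Injective.factorThru (g ≫ Injective.ι M'') (Injective.ι M')) (by simp),
      Category.assoc, derivedMap_ι F g _ (Injective.comp_factorThru _ _),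
      ← Category.assoc, derivedMap_ι F f _ (Injective.comp_factorThru _ _)]
    simp

/-- The inclusion of the value at `M` of the zeroth right derived functor of `F` in
the value of `F` at the injective object containing `M`. -/
noncomputable def derivedι (M : X) : (derived F).obj M ⟶ F.obj (Injective.under M) :=
  derivedObjι F M

instance (M : X) : Mono (derivedι F M) := inferInstanceAs (Mono (derivedObjι F M))

lemma derivedι_comp (M : X) : derivedι F M ≫ F.map (cokernel.π (Injective.ι M)) = 0 :=
  kernel.condition _

lemma derived_map_ι {M M' : X} (f : M ⟶ M')
    (g : Injective.under M ⟶ Injective.under M') (hg : Injective.ι M ≫ g = f ≫ Injective.ι M') :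
    (derived F).map f ≫ derivedι F M' = derivedι F M ≫ F.map g :=
  derivedMap_ι F f g hg

lemma exists_lift_derivedι (M : X) {T : X} (t : T ⟶ F.obj (Injective.under M))
    (ht : t ≫ F.map (cokernel.π (Injective.ι M)) = 0) :
    ∃ s : T ⟶ (derived F).obj M, s ≫ derivedι F M = t :=
  ⟨kernel.lift _ t ht, kernel.lift_ι _ _ _⟩

/-- The comparison of the zeroth right derived functor of `F` at `M` with `F` at an injective
object to which `M` maps. -/
noncomputable def derivedTo {M B : X} (i : M ⟶ B) [Injective B] :
    (derived F).obj M ⟶ F.obj B :=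
  derivedι F M ≫ F.map (Injective.factorThru i (Injective.ι M))

lemma derived_map_comp_derivedTo {M M' B B' : X} [Injective B] [Injective B'] (f : M ⟶ M')
    (i : M ⟶ B) (i' : M' ⟶ B') (g : B ⟶ B') (h : i ≫ g = f ≫ i') :
    (derived F).map f ≫ derivedTo F i' = derivedTo F i ≫ F.map g := by
  have ha : Injective.ι M ≫ Injective.factorThru (f ≫ Injective.ι M') (Injective.ι M) =
      f ≫ Injective.ι M' := Injective.comp_factorThru _ _
  rw [derivedTo, derivedTo, reassoc_of% (derived_map_ι F f _ ha), Category.assoc, ← F.map_comp,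
    ← F.map_comp]
  refine map_eq_map_of_comp_eq F _ _ (derivedι_comp F M) _ _ ?_
  rw [reassoc_of% ha, Injective.comp_factorThru, Injective.comp_factorThru_assoc, h]

lemma derivedTo_comp {M B : X} [Injective B] (i : M ⟶ B) {C : X} (q : B ⟶ C) (hq : i ≫ q = 0) :
    derivedTo F i ≫ F.map q = 0 := by
  rw [derivedTo, Category.assoc, ← F.map_comp,
    map_eq_map_of_comp_eq F _ _ (derivedι_comp F M) _ 0
      (by rw [Injective.comp_factorThru_assoc, hq, comp_zero]), F.map_zero, comp_zero]

lemma derivedTo_comp_map {M B : X} [Injective B] (i : M ⟶ B) [Mono i] :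
    derivedTo F i ≫ F.map (Injective.factorThru (Injective.ι M) i) = derivedι F M := by
  rw [derivedTo, Category.assoc, ← F.map_comp,
    map_eq_map_of_comp_eq F _ _ (derivedι_comp F M) _ (𝟙 _) (by simp), F.map_id, Category.comp_id]

instance {M B : X} [Injective B] (i : M ⟶ B) [Mono i] : Mono (derivedTo F i) := by
  have : Mono (derivedTo F i ≫ F.map (Injective.factorThru (Injective.ι M) i)) := by
    rw [derivedTo_comp_map]
    infer_instance
  exact mono_of_mono _ (F.map (Injective.factorThru (Injective.ι M) i))

/-- Since `derivedTo F i` is a monomorphism, this shows that any embedding into an injective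
computes the derived functor. -/
lemma exists_lift_derivedTo {M B : X} [Injective B] (i : M ⟶ B) [Mono i] {T : X}
    (t : T ⟶ F.obj B) (ht : t ≫ F.map (cokernel.π i) = 0) :
    ∃ s : T ⟶ (derived F).obj M, s ≫ derivedTo F i = t := by
  let g := Injective.factorThru (Injective.ι M) i
  have hg : i ≫ g = Injective.ι M := Injective.comp_factorThru _ _
  obtain ⟨s, hs⟩ := exists_lift_derivedι F M (t ≫ F.map g) (by
    rw [Category.assoc, ← F.map_comp, map_eq_map_of_comp_eq F i t ht _ 0
      (by rw [reassoc_of% hg]; simp), F.map_zero, comp_zero])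
  refine ⟨s, ?_⟩
  rw [derivedTo, reassoc_of% hs, ← F.map_comp, map_eq_map_of_comp_eq F i t ht _ (𝟙 _)
    (by rw [reassoc_of% hg]; simp), F.map_id, Category.comp_id]

instance (J : X) [Injective J] : IsIso (derivedTo F (𝟙 J)) := by
  obtain ⟨s, hs⟩ := exists_lift_derivedTo F (𝟙 J) (𝟙 _) (by simp [cokernel.π_of_epi])
  have : IsSplitEpi (derivedTo F (𝟙 J)) := ⟨⟨⟨s, hs⟩⟩⟩
  exact isIso_of_mono_of_isSplitEpi _

instance : (derived F).Additive where
  map_add {M M' f g} := by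
    rw [← cancel_mono (derivedTo F (Injective.ι M'))]
    rw [Preadditive.add_comp,
      derived_map_comp_derivedTo F f (Injective.ι M) _ _ (Injective.comp_factorThru _ _),
      derived_map_comp_derivedTo F g (Injective.ι M) _ _ (Injective.comp_factorThru _ _),
      derived_map_comp_derivedTo F (f + g) (Injective.ι M) _
        (Injective.factorThru (f ≫ Injective.ι M') (Injective.ι M) +
          Injective.factorThru (g ≫ Injective.ι M') (Injective.ι M)) (by simp),
      F.map_add, Preadditive.comp_add]

/-- Embed `S.X₂`, and hence `S.X₁`, in one injective `J`. Then `S.X₃` embeds in `J/S.X₁`, and that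
quotient in a second injective, so all three values are computed inside values of `F` on injectives.
-/
lemma preservesFiniteLimits_derived [F.PreservesMonomorphisms] :
    PreservesFiniteLimits (derived F) := by
  refine ((derived F).preservesFiniteLimits_tfae.out 0 3).1 fun S hS => ?_
  have := hS.mono_f
  have := hS.epi_g
  let i := Injective.ι S.X₂
  let q := cokernel.π (S.f ≫ i)
  obtain ⟨m, hm⟩ := CokernelCofork.IsColimit.desc' hS.gIsCokernel (i ≫ q) (by
    rw [← Category.assoc]
    exact cokernel.condition _)
  have hm : S.g ≫ m = i ≫ q := hm
  have : Mono m := mono_of_shortExact_of_comp hS i m hm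
  let j := Injective.ι (cokernel (S.f ≫ i))
  have h₁ : (derived F).map S.f ≫ derivedTo F i = derivedTo F (S.f ≫ i) := by
    simpa using derived_map_comp_derivedTo F S.f (S.f ≫ i) i (𝟙 _) (by simp)
  have h₂ : (derived F).map S.g ≫ derivedTo F (m ≫ j) = derivedTo F i ≫ F.map (q ≫ j) :=
    derived_map_comp_derivedTo F S.g i (m ≫ j) (q ≫ j) (by rw [reassoc_of% hm])
  constructor
  · refine exact_map_of_exists_lift _ S fun T x hx => ?_
    obtain ⟨s, hs⟩ := exists_lift_derivedTo F (S.f ≫ i) (x ≫ derivedTo F i) (by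
      -- `F` preserves the monomorphism `j`, so vanishing may be tested after `F.map j`.
      rw [← cancel_mono (F.map j), Category.assoc, Category.assoc, ← F.map_comp, ← h₂,
        reassoc_of% hx, zero_comp, zero_comp])
    exact ⟨s, by rw [← cancel_mono (derivedTo F i), Category.assoc, h₁, hs]⟩
  · have : Mono ((derived F).map S.f ≫ derivedTo F i) := by
      rw [h₁]
      infer_instance
    exact mono_of_mono _ (derivedTo F i)

variable {F} (p : 𝟭 X ⟶ F)

lemma exists_toDerived : ∃ μ : 𝟭 X ⟶ derived F,
    ∀ M, μ.app M ≫ derivedι F M = Injective.ι M ≫ p.app (Injective.under M) := by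
  choose μ hμ using fun M => exists_lift_derivedι F M (Injective.ι M ≫ p.app (Injective.under M))
    (by
      rw [Category.assoc, ← p.naturality]
      simp)
  refine ⟨{ app := μ, naturality := fun M M' f => ?_ }, hμ⟩
  have ha : Injective.ι M ≫ Injective.factorThru (f ≫ Injective.ι M') (Injective.ι M) =
      f ≫ Injective.ι M' := Injective.comp_factorThru _ _
  change f ≫ μ M' = μ M ≫ (derived F).map f
  rw [← cancel_mono (derivedι F M'), Category.assoc, Category.assoc, derived_map_ι F f _ ha, hμ,
    reassoc_of% (hμ M), ← p.naturality]
  dsimp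
  rw [reassoc_of% ha]

/-- The natural transformation to the zeroth right derived functor of `F` induced by a natural
transformation `𝟭 X ⟶ F`. -/
noncomputable def toDerived : 𝟭 X ⟶ derived F := (exists_toDerived p).choose

lemma toDerived_app_ι (M : X) : (toDerived p).app M ≫ derivedι F M =
    Injective.ι M ≫ p.app (Injective.under M) := (exists_toDerived p).choose_spec M

lemma toDerived_app_ι_assoc (M : X) {T : X} (h : F.obj (Injective.under M) ⟶ T) :
    (toDerived p).app M ≫ derivedι F M ≫ h =
      Injective.ι M ≫ p.app (Injective.under M) ≫ h := by
  refine (Category.assoc _ _ _).symm.trans ?_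
  rw [toDerived_app_ι]
  exact Category.assoc _ _ _

lemma toDerived_app_comp {M B : X} [Injective B] (i : M ⟶ B) :
    (toDerived p).app M ≫ derivedTo F i = i ≫ p.app B := by
  refine (toDerived_app_ι_assoc p M _).trans ?_
  rw [← p.naturality]
  dsimp
  rw [Injective.comp_factorThru_assoc]

lemma toDerived_app_of_injective (J : X) [Injective J] :
    (toDerived p).app J ≫ derivedTo F (𝟙 J) = p.app J :=
  (toDerived_app_comp p (𝟙 J)).trans (Category.id_comp _)

lemma epi_toDerived_app (J : X) [Injective J] [Epi (p.app J)] : Epi ((toDerived p).app J) := by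
  have : (toDerived p).app J = p.app J ≫ inv (derivedTo F (𝟙 J)) := by
    rw [← toDerived_app_of_injective p, Category.assoc, IsIso.hom_inv_id, Category.comp_id]
  rw [this]
  exact epi_comp _ _

variable {H : X ⥤ X} [PreservesFiniteLimits H]

/-- Morphisms from the zeroth right derived functor of `F` to a left exact functor are
determined on injective objects. -/
lemma derived_hom_ext [∀ M, Epi (p.app M)] {a b : derived F ⟶ H}
    (h : toDerived p ≫ a = toDerived p ≫ b) : a = b := by
  ext M
  have hJ : a.app (Injective.under M) = b.app (Injective.under M) := by
    have := epi_toDerived_app p (Injective.under M)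
    rw [← cancel_epi ((toDerived p).app (Injective.under M))]
    exact NatTrans.congr_app h _
  rw [← cancel_mono (H.map (Injective.ι M)), ← a.naturality, ← b.naturality, hJ]

variable [H.Additive]

/-- At the injective `J` containing `M`, `b` sends `derived F M` into the kernel of `H J ⟶ H (J/M)`,
which is `H M` by left exactness. -/
lemma exists_derived_desc (b : F ⟶ H) : ∃ c : derived F ⟶ H, toDerived p ≫ c = p ≫ b := by
  have hl (M : X) : ∃ c : (derived F).obj M ⟶ H.obj M,
      c ≫ H.map (Injective.ι M) = derivedι F M ≫ b.app _ := by
    have hS : (ShortComplex.mk (Injective.ι M) (cokernel.π (Injective.ι M))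
        (cokernel.condition _)).ShortExact := shortExact_cokernel _
    refine exists_lift_map H hS (derivedι F M ≫ b.app _) ?_
    rw [Category.assoc, ← b.naturality, reassoc_of% (derivedι_comp F M), zero_comp]
  choose c hc using hl
  refine ⟨{ app := c, naturality := fun M M' f => ?_ }, ?_⟩
  · obtain ⟨a, ha⟩ : ∃ a, Injective.ι M ≫ a = f ≫ Injective.ι M' :=
      ⟨_, Injective.comp_factorThru _ (Injective.ι M)⟩
    rw [← cancel_mono (H.map (Injective.ι M')), Category.assoc, Category.assoc, hc,
      reassoc_of% (derived_map_ι F f _ ha), b.naturality, ← H.map_comp, ← ha, H.map_comp,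
      reassoc_of% (hc M)]
  · ext M
    rw [← cancel_mono (H.map (Injective.ι M))]
    dsimp
    rw [Category.assoc, hc, toDerived_app_ι_assoc, Category.assoc, ← b.naturality,
      ← Category.assoc, ← Category.assoc]
    congr 1
    exact (p.naturality (Injective.ι M))

end LeftExactReflection

/-! ### The largest subobject in `Z` and the functor `G_Z` -/

section Closed

variable {X : Type u} [Category.{v} X] (Z : ObjectProperty X) [IsClosedSubcategory Z]

lemma preservesLimits_ι : PreservesLimitsOfSize.{v, v} Z.ι :=
  (Adjunction.ofIsRightAdjoint Z.ι).rightAdjoint_preservesLimits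

/-- The largest subobject of `M` that lies in `Z`. -/
noncomputable def part (M : X) : X := (Z.ι.rightAdjoint.obj M).obj

/-- The inclusion of the largest subobject of `M` that lies in `Z`. -/
noncomputable def partι (M : X) : part Z M ⟶ M :=
  (Adjunction.ofIsLeftAdjoint Z.ι).counit.app M

lemma prop_part (M : X) : Z (part Z M) := (Z.ι.rightAdjoint.obj M).property

lemma exists_lift_partι {A M : X} (hA : Z A) (x : A ⟶ M) : ∃ y, y ≫ partι Z M = x := by
  let adj := Adjunction.ofIsLeftAdjoint Z.ι
  let A' : Z.FullSubcategory := ⟨A, hA⟩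
  exact ⟨Z.ι.map (adj.homEquiv A' M x), by
    have := (adj.homEquiv A' M).symm_apply_apply x
    rwa [Adjunction.homEquiv_counit] at this⟩

/-- The functoriality of the largest subobject that lies in `Z`. -/
noncomputable def partMap {M M' : X} (f : M ⟶ M') : part Z M ⟶ part Z M' :=
  Z.ι.map (Z.ι.rightAdjoint.map f)

lemma partMap_comp {M M' : X} (f : M ⟶ M') : partMap Z f ≫ partι Z M' = partι Z M ≫ f :=
  (Adjunction.ofIsLeftAdjoint Z.ι).counit.naturality f

/-- The left adjoint of the inclusion enters here: the inclusion preserves products. -/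
lemma prop_pi [HasProducts.{v} X] {I : Type v} (A : I → X) (hA : ∀ i, Z (A i)) : Z (∏ᶜ A) := by
  have := preservesLimits_ι Z
  let A' (i : I) : Z.FullSubcategory := ⟨A i, hA i⟩
  exact Z.prop_of_iso (PreservesProduct.iso Z.ι A') (∏ᶜ A').property

variable [Abelian X]

open scoped ZeroObject

instance containsZero_of_isClosedSubcategory : Z.ContainsZero := by
  let A := Z.ι.leftAdjoint.obj (0 : X)
  exact ⟨0, isZero_zero X, Z.prop_of_mono (0 : (0 : X) ⟶ A.obj) A.property⟩

instance isClosedUnderCokernels_of_isClosedSubcategory : Z.IsClosedUnderCokernels where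
  cokernels_le := by
    rintro _ ⟨_, k, hk, hf⟩
    have := Cofork.IsColimit.epi hk
    exact Z.prop_of_epi k.π hf.2

instance isClosedUnderFiniteProducts_of_isClosedSubcategory : Z.IsClosedUnderFiniteProducts where
  isClosedUnderLimitsOfShape J _ := by
    have : Reflective Z.ι :=
      { L := Z.ι.leftAdjoint, adj := Adjunction.ofIsRightAdjoint Z.ι }
    have := hasLimitsOfShape_of_reflective (J := Discrete J) Z.ι
    have : PreservesLimitsOfShape (Discrete J) Z.ι :=
      have := (Adjunction.ofIsRightAdjoint Z.ι).rightAdjoint_preservesLimits.{0, 0}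
      inferInstance
    exact Z.isClosedUnderLimitsOfShape_of_preservesLimitsOfShape_ι _

instance (M : X) : Mono (partι Z M) := by
  let adj := Adjunction.ofIsLeftAdjoint Z.ι
  refine Preadditive.mono_of_kernel_zero ?_
  let K : Z.FullSubcategory := ⟨kernel (partι Z M), Z.prop_of_mono (kernel.ι _) (prop_part Z M)⟩
  let k : K ⟶ Z.ι.rightAdjoint.obj M := ObjectProperty.homMk (kernel.ι (partι Z M))
  have : k = 0 := by
    apply (adj.homEquiv K M).symm.injective
    rw [Adjunction.homEquiv_counit, Adjunction.homEquiv_counit]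
    have h₁ : Z.ι.map k ≫ adj.counit.app M = 0 := kernel.condition (partι Z M)
    have h₂ : Z.ι.map (0 : K ⟶ Z.ι.rightAdjoint.obj M) ≫ adj.counit.app M = 0 := zero_comp
    rw [h₁, h₂]
  exact congrArg (·.hom) this

/-- The functor that sends `M` to its quotient by the largest subobject that lies in `Z`. -/
noncomputable def quot : X ⥤ X where
  obj M := cokernel (partι Z M)
  map f := cokernel.map _ _ (partMap Z f) f (partMap_comp Z f).symm

/-- The projection of `M` onto its quotient by the largest subobject that lies in `Z`. -/
noncomputable def proj (M : X) : M ⟶ (quot Z).obj M := cokernel.π (partι Z M)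

instance (M : X) : Epi (proj Z M) := inferInstanceAs (Epi (cokernel.π _))

lemma partι_comp_proj (M : X) : partι Z M ≫ proj Z M = 0 := cokernel.condition _

lemma proj_naturality {M M' : X} (f : M ⟶ M') :
    proj Z M ≫ (quot Z).map f = f ≫ proj Z M' := cokernel.π_desc _ _ _

lemma exists_lift_of_comp_proj {M T : X} (x : T ⟶ M) (hx : x ≫ proj Z M = 0) :
    ∃ y, y ≫ partι Z M = x :=
  ⟨(ShortComplex.exact_cokernel (partι Z M)).lift x hx, ShortComplex.Exact.lift_f _ _ _⟩

lemma exists_desc_proj {M N : X} (f : M ⟶ N) (hf : partι Z M ≫ f = 0) :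
    ∃ g : (quot Z).obj M ⟶ N, proj Z M ≫ g = f :=
  ⟨cokernel.desc _ f hf, cokernel.π_desc _ _ _⟩

/-- The projection of the identity functor onto `quot Z`. -/
noncomputable def quotπ : 𝟭 X ⟶ quot Z where
  app M := proj Z M
  naturality _ _ f := (proj_naturality Z f).symm

instance (M : X) : Epi ((quotπ Z).app M) := inferInstanceAs (Epi (proj Z M))

instance : (quot Z).Additive where
  map_add {M M' f g} := by
    rw [← cancel_epi (proj Z M), Preadditive.comp_add, proj_naturality, proj_naturality,
      proj_naturality, Preadditive.add_comp]

/-- For `M ⊆ M'` one has `o_Z M = M ∩ o_Z M'`: the intersection is a subobject of `o_Z M'`, hence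
lies in `Z`. -/
instance : (quot Z).PreservesMonomorphisms where
  preserves {M M'} f hf := by
    refine Preadditive.mono_of_cancel_zero _ fun {T} x hx => ?_
    obtain ⟨T', π, hπ, m, hm⟩ := surjective_up_to_refinements_of_epi (proj Z M) x
    let d : M ⟶ (quot Z).obj M' := f ≫ proj Z M'
    obtain ⟨a, ha⟩ := exists_lift_of_comp_proj Z (kernel.ι d ≫ f) (by
      rw [Category.assoc]
      exact kernel.condition d)
    have : Mono (a ≫ partι Z M') := by
      rw [ha]
      infer_instance
    have : Mono a := mono_of_mono a (partι Z M')
    obtain ⟨b, hb⟩ := exists_lift_partι Z (Z.prop_of_mono a (prop_part Z M')) (kernel.ι d)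
    have hmd : m ≫ d = 0 := by
      dsimp only [d]
      rw [← proj_naturality Z f, ← reassoc_of% hm, hx, comp_zero]
    have hm' : m = kernel.lift d m hmd ≫ b ≫ partι Z M := by rw [hb, kernel.lift_ι]
    rw [← cancel_epi π, hm, hm', comp_zero, Category.assoc, Category.assoc, partι_comp_proj,
      comp_zero, comp_zero]

/-- A map into `∏ᶜ B` whose components land in the `o_Z (B i)` lands in their product, which belongs
to `Z` and so maps into `o_Z (∏ᶜ B)`. -/
lemma eq_zero_of_forall_comp_quot_map [HasProducts.{v} X] {I : Type v} (B : I → X) {T : X}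
    (x : T ⟶ (quot Z).obj (∏ᶜ B)) (hx : ∀ i, x ≫ (quot Z).map (Pi.π B i) = 0) : x = 0 := by
  obtain ⟨T', π, hπ, b, hb⟩ := surjective_up_to_refinements_of_epi (proj Z (∏ᶜ B)) x
  have h (i : I) : (b ≫ Pi.π B i) ≫ proj Z (B i) = 0 := by
    rw [Category.assoc, ← proj_naturality, ← reassoc_of% hb, hx, comp_zero]
  choose t ht using fun i => exists_lift_of_comp_proj Z _ (h i)
  obtain ⟨q, hq⟩ := exists_lift_partι Z (prop_pi Z _ fun i => prop_part Z (B i))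
    (Limits.Pi.map fun i => partι Z (B i))
  have hb' : b = Pi.lift t ≫ q ≫ partι Z (∏ᶜ B) := by
    rw [hq]
    exact Pi.hom_ext _ _ fun i => by simp [ht]
  rw [← cancel_epi π, hb, hb', Category.assoc, Category.assoc, partι_comp_proj]
  simp

lemma exists_quot_desc {H : X ⥤ X} (φ : 𝟭 X ⟶ H) (hφ : ∀ M : X, partι Z M ≫ φ.app M = 0) :
    ∃ b : quot Z ⟶ H, quotπ Z ≫ b = φ := by
  have hl (M : X) : ∃ g : (quot Z).obj M ⟶ H.obj M, proj Z M ≫ g = φ.app M :=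
    exists_desc_proj Z (φ.app M) (hφ M)
  choose b hb using hl
  refine ⟨{ app := b, naturality := fun M M' f => ?_ }, ?_⟩
  · rw [← cancel_epi (proj Z M), reassoc_of% (proj_naturality Z f), hb, reassoc_of% (hb M)]
    exact φ.naturality f
  · ext M
    exact hb M

lemma additive_of_preservesFiniteLimits (H : X ⥤ X) [PreservesFiniteLimits H] : H.Additive :=
  H.additive_of_preserves_binary_products

variable [EnoughInjectives X]

/-- The functor `G_Z`. -/
noncomputable def gZ : X ⥤ₗ X :=
  ⟨derived (quot Z), preservesFiniteLimits_derived (quot Z)⟩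

/-- The projection of the identity functor to `G_Z`. -/
noncomputable def gZπ : oX ⟶ gZ Z := ObjectProperty.homMk (toDerived (quotπ Z))

lemma oZι_comp_gZπ : oZι Z ≫ gZπ Z = 0 := by
  apply ObjectProperty.hom_ext
  ext M
  change partι Z M ≫ (toDerived (quotπ Z)).app M = 0
  rw [← cancel_mono (derivedι (quot Z) M), Category.assoc, zero_comp]
  have h : (toDerived (quotπ Z)).app M ≫ derivedι (quot Z) M =
      proj Z M ≫ (quot Z).map (Injective.ι M) :=
    (toDerived_app_ι (quotπ Z) M).trans (proj_naturality Z (Injective.ι M)).symm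
  refine (congrArg (partι Z M ≫ ·) h).trans ?_
  rw [reassoc_of% (partι_comp_proj Z M), zero_comp]

/-- `quot Z` is the cokernel among all functors, and `derived` reflects it into left exact ones. -/
lemma nonempty_isColimit_gZ :
    Nonempty (IsColimit (CokernelCofork.ofπ (gZπ Z) (oZι_comp_gZπ Z))) := by
  have hd {H : X ⥤ₗ X} (φ : oX ⟶ H) (hφ : oZι Z ≫ φ = 0) : ∃ ψ : gZ Z ⟶ H, gZπ Z ≫ ψ = φ := by
    have := additive_of_preservesFiniteLimits H.obj
    have h0 (M : X) : partι Z M ≫ φ.hom.app M = 0 :=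
      NatTrans.congr_app (congrArg (·.hom) hφ) M
    obtain ⟨b, hb⟩ := exists_quot_desc Z φ.hom h0
    obtain ⟨c, hc⟩ := exists_derived_desc (quotπ Z) b
    refine ⟨ObjectProperty.homMk c, ?_⟩
    apply ObjectProperty.hom_ext
    exact hc.trans hb
  refine ⟨CokernelCofork.IsColimit.ofπ _ _ (fun φ hφ => (hd φ hφ).choose)
    (fun φ hφ => (hd φ hφ).choose_spec) fun {H} φ hφ ψ hψ => ?_⟩
  apply ObjectProperty.hom_ext
  apply derived_hom_ext (quotπ Z)
  exact congrArg (·.hom) (hψ.trans (hd φ hφ).choose_spec.symm)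

lemma isWellClosed_iff : IsWellClosed Z ↔ (derived (quot Z)).IsRightAdjoint := by
  constructor
  · rintro ⟨G, μ, w, ⟨hG⟩, h⟩
    let e := hG.coconePointUniqueUpToIso (nonempty_isColimit_gZ Z).some
    have : ((LeftExactFunctor.forget X X).obj (CokernelCofork.ofπ μ w).pt).IsRightAdjoint := h
    exact Functor.isRightAdjoint_of_iso ((LeftExactFunctor.forget X X).mapIso e)
  · exact fun h => ⟨gZ Z, gZπ Z, oZι_comp_gZπ Z, nonempty_isColimit_gZ Z, h⟩

end Closed

/-! ### Well-closedness and preservation of products -/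

section WellClosedProducts

variable {X : Type u} [Category.{v} X] [Abelian X] (Z : ObjectProperty X) [IsClosedSubcategory Z]

lemma prop_kernel_proj (M : X) : Z (kernel (proj Z M)) := by
  obtain ⟨y, hy⟩ := exists_lift_of_comp_proj Z (kernel.ι (proj Z M)) (kernel.condition _)
  have : Mono (y ≫ partι Z M) := by
    rw [hy]
    infer_instance
  have : Mono y := mono_of_mono y (partι Z M)
  exact Z.prop_of_mono y (prop_part Z M)

variable [HasProducts.{v} X]

/-- A product of cokernels of monomorphisms contains the cokernel of the product. -/
lemma exists_mono_cokernel_piMap {I : Type v} {A B : I → X} (f : ∀ i, A i ⟶ B i)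
    [∀ i, Mono (f i)] :
    ∃ (c : cokernel (Limits.Pi.map f) ⟶ ∏ᶜ fun i => cokernel (f i)) (_ : Mono c),
      ∀ i, cokernel.π (Limits.Pi.map f) ≫ c ≫ Pi.π _ i = Pi.π B i ≫ cokernel.π (f i) := by
  have h := exact_piMap (fun i => cokernel.condition (f i))
    fun i => ShortComplex.exact_cokernel (f i)
  refine ⟨_, h.mono_cokernelDesc, fun i => ?_⟩
  simp

variable [EnoughInjectives X]

/-- Both sides are computed from the embeddings `M i ⟶ J i` and their product. Injectivity holds
because the projections are jointly monic after `quot Z`; surjectivity comes from lifting along the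
`J i ⟶ J i/o_Z (J i)`. -/
lemma isIso_piComparison_derived (hZ : JointLifting Z) {I : Type v} (M : I → X) :
    IsIso (piComparison (derived (quot Z)) M) := by
  let G := derived (quot Z)
  let j (i : I) := Injective.ι (M i)
  let k := Limits.Pi.map j
  have hk (i : I) : G.map (Pi.π M i) ≫ derivedTo (quot Z) (j i) =
      derivedTo (quot Z) k ≫ (quot Z).map (Pi.π _ i) :=
    derived_map_comp_derivedTo (quot Z) (Pi.π M i) k (j i) (Pi.π _ i) (by simp [k])
  have : Mono (piComparison G M) := by
    refine Preadditive.mono_of_cancel_zero _ fun {T} x hx => ?_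
    rw [← cancel_mono (derivedTo (quot Z) k), zero_comp]
    refine eq_zero_of_forall_comp_quot_map Z _ _ fun i => ?_
    have hi : x ≫ G.map (Pi.π M i) = 0 := by
      rw [← piComparison_comp_π, reassoc_of% hx, zero_comp]
    rw [Category.assoc, ← hk, reassoc_of% hi, zero_comp]
  have : Epi (piComparison G M) := by
    rw [epi_iff_surjective_up_to_refinements]
    intro T y
    obtain ⟨T', π, hπ, b, hb⟩ := hZ (fun i => proj Z (Injective.under (M i)))
      (fun i => inferInstance) (fun i => prop_kernel_proj Z _)
      fun i => (y ≫ Pi.π _ i) ≫ derivedTo (quot Z) (j i)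
    let w := Pi.lift b ≫ proj Z _
    have hw (i : I) : w ≫ (quot Z).map (Pi.π _ i) =
        π ≫ (y ≫ Pi.π _ i) ≫ derivedTo (quot Z) (j i) := by
      dsimp only [w]
      rw [hb, Category.assoc, proj_naturality, Pi.lift_π_assoc]
    obtain ⟨c, hc, hcπ⟩ := exists_mono_cokernel_piMap j
    -- The cokernel of `k` embeds in the product of the cokernels and `quot Z` preserves this
    -- embedding, so the condition on `w` can be tested on components.
    obtain ⟨s, hs⟩ := exists_lift_derivedTo (quot Z) k w (by
      rw [← cancel_mono ((quot Z).map c), zero_comp]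
      refine eq_zero_of_forall_comp_quot_map Z _ _ fun i => ?_
      rw [Category.assoc, Category.assoc, ← (quot Z).map_comp, ← (quot Z).map_comp, hcπ,
        (quot Z).map_comp, reassoc_of% (hw i), derivedTo_comp _ _ _ (cokernel.condition _),
        comp_zero, comp_zero, comp_zero])
    refine ⟨T', π, hπ, s, Pi.hom_ext _ _ fun i => ?_⟩
    rw [Category.assoc, Category.assoc, piComparison_comp_π,
      ← cancel_mono (derivedTo (quot Z) (j i)), Category.assoc, Category.assoc, Category.assoc, hk,
      reassoc_of% hs, hw, Category.assoc]
  exact isIso_of_mono_of_epi _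

/-- Left exactness and preservation of products give all small limits; the special adjoint functor
theorem applies. -/
lemma isWellClosed_of_jointLifting [HasLimits X] [WellPowered.{v} X] [HasCoseparator X]
    (hZ : JointLifting Z) : IsWellClosed Z := by
  rw [isWellClosed_iff]
  have (I : Type v) : PreservesLimitsOfShape (Discrete I) (derived (quot Z)) := by
    have (M : I → X) : PreservesLimit (Discrete.functor M) (derived (quot Z)) := by
      have := isIso_piComparison_derived Z hZ M
      exact PreservesProduct.of_iso_comparison _ _
    exact preservesLimitsOfShape_of_discrete _
  have := preservesFiniteLimits_derived (quot Z)
  have : PreservesLimits (derived (quot Z)) := preservesLimits_of_preservesEqualizers_and_products _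
  exact isRightAdjoint_of_preservesLimits_of_isCoseparating (isCoseparator_coseparator X) _

/-- On injectives `G_Z` is `J ↦ J/o_Z J`. As `∏ᶜ J` is injective, it maps epimorphically onto `G_Z
(∏ᶜ J)`, which is the product of the `G_Z (J i)`. -/
lemma jointlyLifts_proj_of_isWellClosed (h : IsWellClosed Z) {I : Type v} (J : I → X)
    [∀ i, Injective (J i)] : JointlyLifts fun i => proj Z (J i) := by
  rw [isWellClosed_iff] at h
  have := (Adjunction.ofIsRightAdjoint (derived (quot Z))).rightAdjoint_preservesLimits.{v, v}
  intro T y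
  have : Epi ((toDerived (quotπ Z)).app (∏ᶜ J)) := epi_toDerived_app (quotπ Z) _
  let z : T ⟶ (derived (quot Z)).obj (∏ᶜ J) :=
    Pi.lift (fun i => y i ≫ inv (derivedTo (quot Z) (𝟙 (J i)))) ≫
      inv (piComparison (derived (quot Z)) J)
  have hz (i : I) : z ≫ (derived (quot Z)).map (Pi.π J i) ≫ derivedTo (quot Z) (𝟙 (J i)) = y i := by
    dsimp only [z]
    rw [← piComparison_comp_π]
    simp
  obtain ⟨T', π, hπ, x, hx⟩ :=
    surjective_up_to_refinements_of_epi ((toDerived (quotπ Z)).app (∏ᶜ J)) z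
  let x' : T' ⟶ ∏ᶜ J := x
  refine ⟨T', π, hπ, fun i => x' ≫ Pi.π J i, fun i => ?_⟩
  have h₁ : (toDerived (quotπ Z)).app (J i) ≫ derivedTo (quot Z) (𝟙 (J i)) = proj Z (J i) :=
    toDerived_app_of_injective (quotπ Z) (J i)
  have h₂ : (toDerived (quotπ Z)).app (∏ᶜ J) ≫ (derived (quot Z)).map (Pi.π J i) =
    Pi.π J i ≫ (toDerived (quotπ Z)).app (J i) := ((toDerived (quotπ Z)).naturality _).symm
  calc π ≫ y i
      = (π ≫ z) ≫ (derived (quot Z)).map (Pi.π J i) ≫ derivedTo (quot Z) (𝟙 (J i)) := by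
        rw [Category.assoc, hz]
    _ = x' ≫ ((toDerived (quotπ Z)).app (∏ᶜ J) ≫ (derived (quot Z)).map (Pi.π J i)) ≫
        derivedTo (quot Z) (𝟙 (J i)) := by
        rw [hx]
        simp only [Category.assoc]
        rfl
    _ = x' ≫ Pi.π J i ≫ (toDerived (quotπ Z)).app (J i) ≫ derivedTo (quot Z) (𝟙 (J i)) := by
        rw [h₂]
        exact congrArg (x' ≫ ·) (Category.assoc _ _ _)
    _ = (x' ≫ Pi.π J i) ≫ proj Z (J i) := by
        rw [h₁, Category.assoc]

end WellClosedProducts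

/-! ### Exact products in `Z` -/

section ExactProducts

variable {X : Type u} [Category.{v} X] [Abelian X] [HasProducts.{v} X] (Z : ObjectProperty X)
  [IsClosedSubcategory Z]

/-- The inclusion preserves products, being a right adjoint, and epimorphisms, being a left adjoint;
hence test objects outside `Z` are allowed. -/
lemma jointlyLifts_of_ab4Star [AB4StarOfSize.{v} Z.FullSubcategory] {I : Type v} {A B : I → X}
    (hA : ∀ i, Z (A i)) (hB : ∀ i, Z (B i)) (g : ∀ i, A i ⟶ B i) [∀ i, Epi (g i)] :
    JointlyLifts g := by
  have := preservesLimits_ι Z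
  let A' : Discrete I ⥤ Z.FullSubcategory := Discrete.functor fun i => ⟨A i, hA i⟩
  let B' : Discrete I ⥤ Z.FullSubcategory := Discrete.functor fun i => ⟨B i, hB i⟩
  let φ : A' ⟶ B' := Discrete.natTrans fun i => ObjectProperty.homMk (g i.as)
  have (i : Discrete I) : Epi (φ.app i) :=
    Z.ι.epi_of_epi_map (inferInstanceAs (Epi (g i.as)))
  have : Epi φ := NatTrans.epi_of_epi_app φ
  have : Epi (Z.ι.map (limMap φ)) := by
    have : Epi (limMap φ) := inferInstanceAs (Epi ((lim (J := Discrete I)).map φ))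
    infer_instance
  intro T y
  let hl := isLimitOfPreserves Z.ι (limit.isLimit B')
  let t : T ⟶ Z.ι.obj (limit B') := hl.lift ⟨T, Discrete.natTrans fun i => y i.as⟩
  have ht (i : I) : t ≫ Z.ι.map (limit.π B' ⟨i⟩) = y i := hl.fac _ ⟨i⟩
  obtain ⟨T', π, hπ, x, hx⟩ := surjective_up_to_refinements_of_epi (Z.ι.map (limMap φ)) t
  refine ⟨T', π, hπ, fun i => x ≫ Z.ι.map (limit.π A' ⟨i⟩), fun i => ?_⟩
  have h : Z.ι.map (limMap φ) ≫ Z.ι.map (limit.π B' ⟨i⟩) =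
      Z.ι.map (limit.π A' ⟨i⟩) ≫ g i := by
    rw [← Z.ι.map_comp, limMap_π, Z.ι.map_comp]
    rfl
  rw [← ht, reassoc_of% hx, h]
  exact (Category.assoc _ _ _).symm

variable {Z} in
lemma ab4Star_of_jointLifting (hZ : JointLifting Z) : AB4StarOfSize.{v} Z.FullSubcategory where
  ofShape I := by
    have := preservesLimits_ι Z
    have : (lim (J := Discrete I) (C := Z.FullSubcategory)).PreservesEpimorphisms := by
      refine ⟨fun {K L} φ hφ => Z.ι.epi_of_epi_map ?_⟩
      have hepi (i : I) : Epi (φ.app ⟨i⟩).hom := by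
        have : Epi (φ.app ⟨i⟩) := inferInstance
        exact inferInstanceAs (Epi (Z.ι.map (φ.app ⟨i⟩)))
      rw [epi_iff_surjective_up_to_refinements]
      intro T y
      let y' : T ⟶ Z.ι.obj (limit L) := y
      obtain ⟨T', π, hπ, x, hx⟩ := hZ (fun i => (φ.app ⟨i⟩).hom) hepi
        (fun i => Z.prop_of_mono (kernel.ι _) (K.obj ⟨i⟩).property)
        fun i => y' ≫ Z.ι.map (limit.π L ⟨i⟩)
      let hl := isLimitOfPreserves Z.ι (limit.isLimit K)
      let t : T' ⟶ Z.ι.obj (limit K) := hl.lift ⟨T', Discrete.natTrans fun i => x i.as⟩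
      have ht (i : I) : t ≫ Z.ι.map (limit.π K ⟨i⟩) = x i := hl.fac _ ⟨i⟩
      refine ⟨T', π, hπ, t, (isLimitOfPreserves Z.ι (limit.isLimit L)).hom_ext fun ⟨i⟩ => ?_⟩
      have h : Z.ι.map (limMap φ) ≫ Z.ι.map (limit.π L ⟨i⟩) =
          Z.ι.map (limit.π K ⟨i⟩) ≫ (φ.app ⟨i⟩).hom := by
        rw [← Z.ι.map_comp, limMap_π, Z.ι.map_comp]
        rfl
      calc (π ≫ y') ≫ Z.ι.map (limit.π L ⟨i⟩) = x i ≫ (φ.app ⟨i⟩).hom := by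
            rw [Category.assoc, hx]
        _ = (t ≫ Z.ι.map (limMap φ)) ≫ Z.ι.map (limit.π L ⟨i⟩) := by
            rw [← ht, Category.assoc, Category.assoc, h]
    exact hasExactLimitsOfShape_of_preservesEpi _ _

variable {Z} in
-- With `N ⊆ o_Z J ⊆ J`, lifting along `J ⟶ J/N` splits into lifting along `J ⟶ J/o_Z J`, by
-- well-closedness, and along `o_Z J ⟶ o_Z J/N`, by exact products in `Z`.
lemma jointLifting_of_isWellClosed [EnoughInjectives X] (h : IsWellClosed Z)
    [AB4StarOfSize.{v} Z.FullSubcategory] : JointLifting Z := by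
  intro I P M f hf hZ
  let N (i : I) := kernel (f i)
  let J (i : I) := Injective.under (N i)
  let ι (i : I) : N i ⟶ J i := Injective.ι (N i)
  choose n hn using fun i => exists_lift_partι Z (hZ i) (ι i)
  have hι (i : I) : ι i ≫ proj Z (J i) = 0 := by
    rw [← hn, Category.assoc, partι_comp_proj, comp_zero]
  let d (i : I) : cokernel (ι i) ⟶ (quot Z).obj (J i) := cokernel.desc _ _ (hι i)
  have hd (i : I) : cokernel.π (ι i) ≫ d i = proj Z (J i) := cokernel.π_desc _ _ _
  let q (i : I) : part Z (J i) ⟶ kernel (d i) :=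
    kernel.lift _ (partι Z (J i) ≫ cokernel.π (ι i)) (by
      rw [Category.assoc, hd, partι_comp_proj])
  have hq (i : I) : q i ≫ kernel.ι (d i) = partι Z (J i) ≫ cokernel.π (ι i) :=
    kernel.lift_ι _ _ _
  -- The kernel of `J/N ⟶ J/o_Z J` is the image of `o_Z J`, hence a quotient of an object of `Z`.
  have (i : I) : Epi (q i) := by
    rw [epi_iff_surjective_up_to_refinements]
    intro T t
    obtain ⟨T', π, hπ, a, ha⟩ :=
      surjective_up_to_refinements_of_epi (cokernel.π (ι i)) (t ≫ kernel.ι (d i))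
    obtain ⟨b, hb⟩ := exists_lift_of_comp_proj Z a (by
      rw [← hd, ← reassoc_of% ha, kernel.condition, comp_zero, comp_zero])
    refine ⟨T', π, hπ, b, ?_⟩
    rw [← cancel_mono (kernel.ι (d i)), Category.assoc, Category.assoc, hq, reassoc_of% hb, ha]
  have hc : JointlyLifts fun i => cokernel.π (ι i) := by
    intro T y
    obtain ⟨T', π, hπ, x, hx⟩ := jointlyLifts_proj_of_isWellClosed Z h J fun i => y i ≫ d i
    obtain ⟨T'', ρ, hρ, v, hv⟩ := jointlyLifts_of_ab4Star Z (fun i => prop_part Z (J i))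
      (fun i => Z.prop_of_epi (q i) (prop_part Z (J i))) q
      -- The first lift `x` is correct only modulo `kernel (d i)`; its error is lifted to `o_Z J`
      -- and added back.
      fun i => kernel.lift (d i) (π ≫ y i - x i ≫ cokernel.π (ι i)) (by
        rw [Preadditive.sub_comp, Category.assoc, Category.assoc, hd, hx, sub_self])
    refine ⟨T'', ρ ≫ π, epi_comp _ _, fun i => ρ ≫ x i + v i ≫ partι Z (J i), fun i => ?_⟩
    have hvi := hv i =≫ kernel.ι (d i)
    rw [Category.assoc, kernel.lift_ι, Category.assoc, hq] at hvi
    rw [Preadditive.add_comp, Category.assoc, Category.assoc, Category.assoc, ← hvi,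
      Preadditive.comp_sub]
    abel
  exact hc.of_shortExact (S₁ := fun i => ShortComplex.mk (kernel.ι (f i)) (f i) _)
    (S₂ := fun i => ShortComplex.mk (ι i) (cokernel.π (ι i)) (cokernel.condition _))
    (fun i => have := hf i; shortExact_kernel (f i)) (fun i => shortExact_cokernel (ι i))
    (fun i => 𝟙 (N i)) (fun i => inferInstanceAs (IsIso (𝟙 (N i))))
    (fun i => Injective.factorThru (ι i) (kernel.ι (f i)))
    fun i => (Injective.comp_factorThru _ _).trans (Category.id_comp _).symm

end ExactProducts

end ClosedSubcat

theorem mainTheorem2 {X : Type u} [Category.{v} X] [Abelian X] [IsGrothendieckAbelian.{v} X]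
    (hX : ClosedSubcat.IsLocallyNoetherian X)
    (Z : ObjectProperty X) [ClosedSubcat.IsClosedSubcategory Z] :
    List.TFAE [
      ∀ (I : Type v) (N : I → X), (∀ i, Z (N i)) → IsZero (ClosedSubcat.R1Prod N),
      ClosedSubcat.IsWellClosed Z ∧ AB4StarOfSize.{v} Z.FullSubcategory,
      ∀ (I : Type v) (N : I → X), (∀ i, Z (N i)) →
        ∀ M : X, Function.Bijective (ClosedSubcat.extProdMap M N),
      ∀ M : X, ∃ (M' : X) (π : M' ⟶ M), ClosedSubcat.IsProjectiveEffacement Z π] := by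
  have h1 : (∀ (I : Type v) (N : I → X), (∀ i, Z (N i)) → IsZero (ClosedSubcat.R1Prod N)) ↔
      ClosedSubcat.JointLifting Z :=
    ⟨ClosedSubcat.jointLifting_of_isZero_R1Prod,
      fun h _ N hN => ClosedSubcat.isZero_R1Prod h N hN⟩
  have h2 : (ClosedSubcat.IsWellClosed Z ∧ AB4StarOfSize.{v} Z.FullSubcategory) ↔
      ClosedSubcat.JointLifting Z :=
    ⟨fun ⟨h, _⟩ => ClosedSubcat.jointLifting_of_isWellClosed h, fun h =>
      ⟨ClosedSubcat.isWellClosed_of_jointLifting Z h, ClosedSubcat.ab4Star_of_jointLifting h⟩⟩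
  have h3 : (∀ (I : Type v) (N : I → X), (∀ i, Z (N i)) →
      ∀ M : X, Function.Bijective (ClosedSubcat.extProdMap M N)) ↔ ClosedSubcat.JointLifting Z :=
    ⟨ClosedSubcat.jointLifting_of_bijective_extProdMap,
      fun h _ N hN M => ClosedSubcat.bijective_extProdMap h N hN M⟩
  have h4 : (∀ M : X, ∃ (M' : X) (π : M' ⟶ M), ClosedSubcat.IsProjectiveEffacement Z π) ↔
      ClosedSubcat.JointLifting Z :=
    ⟨ClosedSubcat.jointLifting_of_exists_effacement, fun h => ClosedSubcat.exists_effacement hX h⟩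
  tfae_have 1 ↔ 2 := h1.trans h2.symm
  tfae_have 1 ↔ 3 := h1.trans h3.symm
  tfae_have 1 ↔ 4 := h1.trans h4.symm
  tfae_finish
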